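/- **Theorem 1 (the general Lagrangian for GET).** Fix $G>0$ and real constants $\Upsilon,\Xi$, and put $\gamma_{\mu\nu}=\mathrm{diag}(\Upsilon,-\Xi,-\Xi,-\Xi)$. Consider on $\mathbb R^4$ (with arbitrary coordinates $x^\alpha$) smooth fields: a metric $g_{\alpha\beta}$ of signature $(+,-,-,-)$, the preferred coordinates treated as four arbitrary smooth scalar fields $X^\mu(x)$, and finitely many tensor fields $\varphi^m$ (the matter fields). A Lagrangian is a smooth function of the values and of the partial derivatives, up to some finite order, of the fields, defined for all metrics of this signature and all values of the other fields and of all derivatives. Its action is $S=\int L\,d^4x$. Two Lagrangians are identified, written $\simeq$, if their actions agree up to boundary terms, that is, if every change of the fields inside a compact set changes both actions by the same amount. Write $\Box X^\nu=\partial_\alpha(g^{\alpha\beta}\sqrt{-g}\,\partial_\beta X^\nu)$; in the preferred coordinates, $X^\mu(x)=x^\mu$, this is $\partial_\mu(g^{\mu\nu}\sqrt{-g})$, and $\Box X^\nu=0$ are the continuity and Euler equations of the ether with $g^{00}\sqrt{-g}=\rho$, $g^{i0}\sqrt{-g}=\rho v^i$, $g^{ij}\sqrt{-g}=\rho v^iv^j+p^{ij}$.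 Let $L=L(g,X,\varphi)$ be a weak covariant Lagrangian, i.e. $L$ transforms as a scalar density under all smooth coordinate changes of $x$ when the $X^\mu$ are transformed as scalar fields. Then the Euler–Lagrange expressions of the preferred coordinates satisfy, identically in all the fields, $$\frac{\delta S}{\delta X^\mu}=(4\pi G)^{-1}\,\gamma_{\mu\nu}\,\Box X^\nu$$ if and only if there are strong covariant Lagrangians $L_{GR}(g)$ and $L_{matter}(g,\varphi)$ (scalar densities that do not depend on the $X^\mu$), with $L_{matter}(g,0)=0$, such that $$L\simeq-(8\pi G)^{-1}\gamma_{\mu\nu}\,X^\mu_{,\alpha}X^\nu_{,\beta}\,g^{\alpha\beta}\sqrt{-g}+L_{GR}(g)+L_{matter}(g,\varphi)$$ and, in the preferred coordinates (for $X^\mu(x)=x^\mu$, as Lagrangians of $g$ and $\varphi$), $$L\simeq-(8\pi G)^{-1}\gamma_{\mu\nu}\,g^{\mu\nu}\sqrt{-g}+L_{GR}(g)+L_{matter}(g,\varphi).$$ -/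

import Mathlib

open scoped ContDiff BigOperators

noncomputable section

namespace GET

/-! ### Fields, jets and Lagrangians on a coordinate patch `ℝ⁴` -/

/-- Coordinate space with arbitrary (not necessarily preferred) coordinates `x⁰, …, x³`. -/
abbrev Spacetime : Type := Fin 4 → ℝ

/-- Values of the four scalar fields `X^μ` (the preferred coordinates). -/
abbrev PrefVal : Type := Fin 4 → ℝ

/-- Components `g_{αβ}` of a covariant two-tensor at a point. -/
abbrev MetricVal : Type := Fin 4 → Fin 4 → ℝ

/-- Components of finitely many tensors `φ^m`; the `m`-th one has `(τ m).1` upper and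
`(τ m).2` lower indices. -/
abbrev MatterVal {N : ℕ} (τ : Fin N → ℕ × ℕ) : Type :=
  (m : Fin N) → (Fin (τ m).1 → Fin 4) → (Fin (τ m).2 → Fin 4) → ℝ

/-- Values of the pair (metric, matter fields). -/
abbrev GRVal {N : ℕ} (τ : Fin N → ℕ × ℕ) : Type := MetricVal × MatterVal τ

/-- Values of the triple (metric, preferred coordinates, matter fields). -/
abbrev FullVal {N : ℕ} (τ : Fin N → ℕ × ℕ) : Type := MetricVal × PrefVal × MatterVal τ

/-- `A` is symmetric of signature `(+,-,-,-)`. -/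
def IsLorentz (A : MetricVal) : Prop :=
  ∃ P : Matrix (Fin 4) (Fin 4) ℝ, IsUnit P.det ∧
    Matrix.of A = P.transpose * Matrix.diagonal ![1, -1, -1, -1] * P

/-- The set of Lorentzian values of the metric. -/
def lorentz : Set MetricVal := {A | IsLorentz A}

/-- The set of admissible values of the pair (metric, matter fields). -/
def grDomain {N : ℕ} (τ : Fin N → ℕ × ℕ) : Set (GRVal τ) := {w | IsLorentz w.1}

/-- The set of admissible values of the triple (metric, preferred coordinates, matter fields). -/
def fullDomain {N : ℕ} (τ : Fin N → ℕ × ℕ) : Set (FullVal τ) := {w | IsLorentz w.1}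

/-- A smooth field with values in `D`. -/
def Admissible {W : Type} [NormedAddCommGroup W] [NormedSpace ℝ W] (D : Set W)
    (u : Spacetime → W) : Prop :=
  ContDiff ℝ ∞ u ∧ ∀ x, u x ∈ D

/-- Jets of order `k`: the value and the derivatives up to order `k` at a point. -/
abbrev Jet (k : ℕ) (W : Type) [NormedAddCommGroup W] [NormedSpace ℝ W] : Type :=
  (i : Fin (k + 1)) → ContinuousMultilinearMap ℝ (fun _ : Fin (i : ℕ) => Spacetime) W

/-- The `k`-jet of a field at a point. -/
def jet {W : Type} [NormedAddCommGroup W] [NormedSpace ℝ W] (k : ℕ) (u : Spacetime → W)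
    (x : Spacetime) : Jet k W :=
  fun i => iteratedFDeriv ℝ (i : ℕ) u x

/-- A Lagrangian of some finite order: a smooth function of the fields, taking values in `D`,
and of finitely many of their derivatives. -/
structure Lagrangian (W : Type) [NormedAddCommGroup W] [NormedSpace ℝ W] (D : Set W) where
  /-- the highest order of the derivatives that occur -/
  order : ℕ
  /-- the Lagrangian as a function of the jet -/
  density : Jet order W → ℝ
  /-- the Lagrangian is smooth over the admissible field values -/
  smooth : ContDiffOn ℝ ∞ density {j | j 0 0 ∈ D}

/-- The Lagrangian evaluated on a field configuration: a function of the point. -/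
def Lagrangian.eval {W : Type} [NormedAddCommGroup W] [NormedSpace ℝ W] {D : Set W}
    (L : Lagrangian W D) (u : Spacetime → W) (x : Spacetime) : ℝ :=
  L.density (jet L.order u x)

/-- The change of the action `S = ∫ L d⁴x` from the configuration `u` to `u'`.  It is used only
for configurations that agree outside a compact set. -/
def actionChange {W : Type} (A : (Spacetime → W) → Spacetime → ℝ) (u u' : Spacetime → W) : ℝ :=
  ∫ x, (A u' x - A u x)

/-- Two Lagrangians have the same action up to boundary terms: every change of the fields inside
a compact set changes both actions by the same amount. -/
def SameAction {W : Type} [NormedAddCommGroup W] [NormedSpace ℝ W] (D : Set W)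
    (A B : (Spacetime → W) → Spacetime → ℝ) : Prop :=
  ∀ u u' : Spacetime → W, Admissible D u → Admissible D u' →
    (∃ K : Set Spacetime, IsCompact K ∧ ∀ x, x ∉ K → u' x = u x) →
    actionChange A u u' = actionChange B u u'

/-! ### Coordinate changes and covariance -/

/-- A smooth change of coordinates. -/
def IsCoordChange (ψ : Spacetime ≃ Spacetime) : Prop :=
  ContDiff ℝ ∞ ψ ∧ ContDiff ℝ ∞ ψ.symm

/-- The partial derivative `∂_α f`. -/
def partialDeriv (α : Fin 4) (f : Spacetime → ℝ) (x : Spacetime) : ℝ :=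
  fderiv ℝ f x (Pi.single α 1)

/-- The Jacobian matrix `∂ψ^a/∂x^b`. -/
def jacobian (ψ : Spacetime → Spacetime) (x : Spacetime) : Matrix (Fin 4) (Fin 4) ℝ :=
  Matrix.of fun a b => partialDeriv b (fun y => ψ y a) x

/-- The metric in the new coordinates. -/
def pullMetric (ψ : Spacetime → Spacetime) (g : Spacetime → MetricVal) : Spacetime → MetricVal :=
  fun x a b => ∑ c, ∑ d, jacobian ψ x c a * jacobian ψ x d b * g (ψ x) c d

/-- The matter tensors in the new coordinates. -/
def pullMatter {N : ℕ} {τ : Fin N → ℕ × ℕ} (ψ : Spacetime → Spacetime)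
    (φ : Spacetime → MatterVal τ) : Spacetime → MatterVal τ :=
  fun x m a b => ∑ c : Fin (τ m).1 → Fin 4, ∑ d : Fin (τ m).2 → Fin 4,
    (∏ i, (jacobian ψ x)⁻¹ (a i) (c i)) * (∏ j, jacobian ψ x (d j) (b j)) * φ (ψ x) m c d

/-- Combine a metric and matter fields. -/
def grFields {N : ℕ} {τ : Fin N → ℕ × ℕ} (g : Spacetime → MetricVal)
    (φ : Spacetime → MatterVal τ) : Spacetime → GRVal τ :=
  fun x => (g x, φ x)

/-- Combine a metric, the scalar fields `X^μ` and matter fields. -/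
def fullFields {N : ℕ} {τ : Fin N → ℕ × ℕ} (g : Spacetime → MetricVal) (X : Spacetime → PrefVal)
    (φ : Spacetime → MatterVal τ) : Spacetime → FullVal τ :=
  fun x => (g x, X x, φ x)

/-- Weak covariance: the Lagrangian is a scalar density when the preferred coordinates are
transformed, like the other fields, as four scalar fields `X^μ(x)`. -/
def WeakCovariant {N : ℕ} {τ : Fin N → ℕ × ℕ} (L : Lagrangian (FullVal τ) (fullDomain τ)) :
    Prop :=
  ∀ ψ : Spacetime ≃ Spacetime, IsCoordChange ψ →
    ∀ (g : Spacetime → MetricVal) (X : Spacetime → PrefVal) (φ : Spacetime → MatterVal τ),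
      Admissible lorentz g → ContDiff ℝ ∞ X → ContDiff ℝ ∞ φ → ∀ x,
        L.eval (fullFields (pullMetric ψ g) (X ∘ ψ) (pullMatter ψ φ)) x
          = |(jacobian ψ x).det| * L.eval (fullFields g X φ) (ψ x)

/-- Strong covariance of a Lagrangian of the metric alone. -/
def StrongCovariantMetric (L : Lagrangian MetricVal lorentz) : Prop :=
  ∀ ψ : Spacetime ≃ Spacetime, IsCoordChange ψ →
    ∀ g : Spacetime → MetricVal, Admissible lorentz g → ∀ x,
      L.eval (pullMetric ψ g) x = |(jacobian ψ x).det| * L.eval g (ψ x)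

/-- Strong covariance of a Lagrangian of the metric and the matter fields: it is a scalar density
and does not depend on the preferred coordinates. -/
def StrongCovariantMatter {N : ℕ} {τ : Fin N → ℕ × ℕ} (L : Lagrangian (GRVal τ) (grDomain τ)) :
    Prop :=
  ∀ ψ : Spacetime ≃ Spacetime, IsCoordChange ψ →
    ∀ (g : Spacetime → MetricVal) (φ : Spacetime → MatterVal τ),
      Admissible lorentz g → ContDiff ℝ ∞ φ → ∀ x,
        L.eval (grFields (pullMetric ψ g) (pullMatter ψ φ)) x
          = |(jacobian ψ x).det| * L.eval (grFields g φ) (ψ x)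

/-! ### The harmonic operator and the Lagrange axiom -/

/-- `g^{αβ} √(-g)`. -/
def densInv (A : MetricVal) (α β : Fin 4) : ℝ :=
  (Matrix.of A)⁻¹ α β * Real.sqrt (-(Matrix.of A).det)

/-- `□ f = ∂_α (g^{αβ} √(-g) ∂_β f)`. -/
def box (g : Spacetime → MetricVal) (f : Spacetime → ℝ) (x : Spacetime) : ℝ :=
  ∑ α, partialDeriv α (fun y => ∑ β, densInv (g y) α β * partialDeriv β f y) x

/-- `γ = diag(Υ, -Ξ, -Ξ, -Ξ)`. -/
def gammaMat (Υ Ξ : ℝ) : Matrix (Fin 4) (Fin 4) ℝ :=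
  Matrix.diagonal ![Υ, -Ξ, -Ξ, -Ξ]

/-- `δS/δX^μ = E_μ` at the configuration `(g, X, φ)`, for the action `S = ∫ L d⁴x`. -/
def HasFunctionalDerivX {N : ℕ} {τ : Fin N → ℕ × ℕ} (L : Lagrangian (FullVal τ) (fullDomain τ))
    (g : Spacetime → MetricVal) (X : Spacetime → PrefVal) (φ : Spacetime → MatterVal τ)
    (E : Fin 4 → Spacetime → ℝ) : Prop :=
  ∀ ξ : Spacetime → PrefVal, ContDiff ℝ ∞ ξ → HasCompactSupport ξ →
    HasDerivAt
      (fun s : ℝ => actionChange L.eval (fullFields g X φ) (fullFields g (X + s • ξ) φ))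
      (∫ x, ∑ μ, E μ x * ξ x μ) 0

/-- The Euler-Lagrange expressions of the preferred coordinates are
`δS/δX^μ = (4πG)⁻¹ γ_{μν} □X^ν`, identically in all fields. -/
def LagrangeAxiom {N : ℕ} {τ : Fin N → ℕ × ℕ} (G Υ Ξ : ℝ)
    (L : Lagrangian (FullVal τ) (fullDomain τ)) : Prop :=
  ∀ (g : Spacetime → MetricVal) (X : Spacetime → PrefVal) (φ : Spacetime → MatterVal τ),
    Admissible lorentz g → ContDiff ℝ ∞ X → ContDiff ℝ ∞ φ →
      HasFunctionalDerivX L g X φ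
        (fun μ x => (4 * Real.pi * G)⁻¹ *
          ∑ ν, gammaMat Υ Ξ μ ν * box g (fun y => X y ν) x)

/-- `-(8πG)⁻¹ γ_{μν} X^μ_{,α} X^ν_{,β} g^{αβ} √(-g)`. -/
def etherCov (G Υ Ξ : ℝ) (g : Spacetime → MetricVal) (X : Spacetime → PrefVal)
    (x : Spacetime) : ℝ :=
  -(8 * Real.pi * G)⁻¹ * ∑ μ, ∑ ν, ∑ α, ∑ β,
    gammaMat Υ Ξ μ ν * partialDeriv α (fun y => X y μ) x * partialDeriv β (fun y => X y ν) x
      * densInv (g x) α β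

/-- `-(8πG)⁻¹ γ_{μν} g^{μν} √(-g)`. -/
def etherPref (G Υ Ξ : ℝ) (g : Spacetime → MetricVal) (x : Spacetime) : ℝ :=
  -(8 * Real.pi * G)⁻¹ * ∑ μ, ∑ ν, gammaMat Υ Ξ μ ν * densInv (g x) μ ν

end GET

end

/-!
Constant values of the scalar fields `X^μ` are preserved by all coordinate changes. Hence, for a
weak covariant `L`, the Lagrangians `L(g, 0, 0)` and `L(g, 0, φ) - L(g, 0, 0)` are strong
covariant (`WeakCovariant.strongCovariantMetric_metricPart`,
`WeakCovariant.strongCovariantMatter_matterPart`); they serve as `L_GR` and `L_matter`, and it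
remains to see that `X` enters the action through the ether Lagrangian alone.

Integration by parts (`integral_gradForm`) shows that the ether action is a quadratic polynomial
along `X + s ξ`, with derivative `∫ (4πG)⁻¹ γ_{μν} □X^ν ξ^μ` at `s = 0`
(`actionChange_etherFunctional`). This gives the converse direction at once. If conversely `L`
satisfies the Lagrange axiom, then the difference of `L` and the ether Lagrangian has vanishing
first variation in `X` at every configuration, so its action does not change under finite changes
of `X` with compact support (`IsLocal.actionChange_eq_zero`). To compare two configurations that
agree outside a compact set `K`, one cuts both scalar fields off, making them vanish near `K`;
outside `K` the two densities coincide, and on `K` they are those of `X = 0`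
(`IsLocal.actionChange_eq_actionChange_zero`). Thus the difference has the same action as
`L(g, 0, φ)`, the ether Lagrangian being zero at `X = 0` (`LagrangeAxiom.sameAction`). In the
preferred coordinates one restricts this equivalence to `X = id`.
-/

open Filter Topology MeasureTheory

namespace GET

/-! ### Local functionals and changes of the action -/

section Local

variable {W : Type} [NormedAddCommGroup W] [NormedSpace ℝ W]

/-- A functional of the fields with values in `D` is local when its value at a point depends on
the germ of the fields there only, and is continuous along smooth fields.  This is all that
additivity of the action and cut-off arguments need to know about a Lagrangian. -/
structure IsLocal (D : Set W) (A : (Spacetime → W) → Spacetime → ℝ) : Prop where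
  continuous : ∀ u, Admissible D u → Continuous (A u)
  congr : ∀ u v x, u =ᶠ[𝓝 x] v → A u x = A v x

theorem continuous_jet (k : ℕ) {u : Spacetime → W} (hu : ContDiff ℝ ∞ u) :
    Continuous (jet k u) :=
  continuous_pi fun _ => hu.continuous_iteratedFDeriv (by exact_mod_cast le_top)

theorem jet_congr (k : ℕ) {u v : Spacetime → W} {x : Spacetime} (h : u =ᶠ[𝓝 x] v) :
    jet k u x = jet k v x :=
  funext fun i => (h.iteratedFDeriv ℝ (i : ℕ)).eq_of_nhds

theorem Lagrangian.isLocal {D : Set W} (L : Lagrangian W D) : IsLocal D L.eval where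
  continuous u hu := by
    refine L.smooth.continuousOn.comp_continuous (continuous_jet L.order hu.1) fun x => ?_
    exact hu.2 x
  congr u v x h := by simp only [Lagrangian.eval, jet_congr L.order h]

variable {D : Set W} {A B : (Spacetime → W) → Spacetime → ℝ} {u v w : Spacetime → W}

theorem IsLocal.sub (hA : IsLocal D A) (hB : IsLocal D B) :
    IsLocal D (fun u x => A u x - B u x) where
  continuous u hu := (hA.continuous u hu).sub (hB.continuous u hu)
  congr u v x h := by rw [hA.congr u v x h, hB.congr u v x h]

theorem IsLocal.eq_of_notMem (hA : IsLocal D A) {K : Set Spacetime} (hK : IsCompact K)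
    (h : ∀ x, x ∉ K → v x = u x) {x : Spacetime} (hx : x ∉ K) : A v x = A u x :=
  hA.congr _ _ _ (mem_of_superset (hK.isClosed.isOpen_compl.mem_nhds hx) h)

theorem IsLocal.integrable_sub (hA : IsLocal D A) (hu : Admissible D u) (hv : Admissible D v)
    {K : Set Spacetime} (hK : IsCompact K) (h : ∀ x, x ∉ K → v x = u x) :
    Integrable (fun x => A v x - A u x) :=
  ((hA.continuous v hv).sub (hA.continuous u hu)).integrable_of_hasCompactSupport
    (HasCompactSupport.intro hK fun _ hx => sub_eq_zero.2 (hA.eq_of_notMem hK h hx))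

theorem IsLocal.actionChange_trans (hA : IsLocal D A) (hu : Admissible D u)
    (hv : Admissible D v) (hw : Admissible D w) {K : Set Spacetime} (hK : IsCompact K)
    (huv : ∀ x, x ∉ K → v x = u x) (hvw : ∀ x, x ∉ K → w x = v x) :
    actionChange A u w = actionChange A u v + actionChange A v w := by
  unfold actionChange
  rw [← integral_add (hA.integrable_sub hu hv hK huv) (hA.integrable_sub hv hw hK hvw)]
  exact integral_congr_ae (ae_of_all _ fun x => by ring)

theorem IsLocal.actionChange_sub (hA : IsLocal D A) (hB : IsLocal D B) (hu : Admissible D u)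
    (hv : Admissible D v) {K : Set Spacetime} (hK : IsCompact K)
    (huv : ∀ x, x ∉ K → v x = u x) :
    actionChange (fun u x => A u x - B u x) u v = actionChange A u v - actionChange B u v := by
  unfold actionChange
  rw [← integral_sub (hA.integrable_sub hu hv hK huv) (hB.integrable_sub hu hv hK huv)]
  exact integral_congr_ae (ae_of_all _ fun x => by ring)

end Local

/-! ### Substituting fields into a Lagrangian -/

section Substitution

variable {W W' : Type} [NormedAddCommGroup W] [NormedSpace ℝ W] [NormedAddCommGroup W']
  [NormedSpace ℝ W'] {D : Set W} {D' : Set W'}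

/-- The map of jets induced by a linear map of the field values. -/
noncomputable def jetMap (k : ℕ) (T : W →L[ℝ] W') : Jet k W →L[ℝ] Jet k W' :=
  ContinuousLinearMap.pi fun i =>
    (ContinuousLinearMap.compContinuousMultilinearMapL ℝ (fun _ : Fin (i : ℕ) => Spacetime)
      W W' T).comp (ContinuousLinearMap.proj i)

theorem jetMap_jet (k : ℕ) (T : W →L[ℝ] W') {u : Spacetime → W} (hu : ContDiff ℝ ∞ u)
    (x : Spacetime) : jetMap k T (jet k u x) = jet k (T ∘ u) x := by
  funext i
  exact (T.iteratedFDeriv_comp_left (hu.contDiffAt (x := x)) (i := i)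
    (by exact_mod_cast le_top)).symm

theorem contDiffOn_density_jetMap (L : Lagrangian W' D') (T : W →L[ℝ] W')
    (hT : Set.MapsTo T D D') :
    ContDiffOn ℝ ∞ (fun j => L.density (jetMap L.order T j)) {j | j 0 0 ∈ D} :=
  L.smooth.comp (jetMap L.order T).contDiff.contDiffOn fun _ hj => hT hj

/-- The Lagrangian `u ↦ L(T u)` obtained by a linear substitution of the fields. -/
noncomputable def Lagrangian.comap (L : Lagrangian W' D') (T : W →L[ℝ] W')
    (hT : Set.MapsTo T D D') : Lagrangian W D where
  order := L.order
  density j := L.density (jetMap L.order T j)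
  smooth := contDiffOn_density_jetMap L T hT

/-- The difference `u ↦ L(T u) - L(T' u)` of two linear substitutions into one Lagrangian; both
terms have the same order, so no truncation of jets is needed. -/
noncomputable def Lagrangian.comapSub (L : Lagrangian W' D') (T T' : W →L[ℝ] W')
    (hT : Set.MapsTo T D D') (hT' : Set.MapsTo T' D D') : Lagrangian W D where
  order := L.order
  density j := L.density (jetMap L.order T j) - L.density (jetMap L.order T' j)
  smooth := (contDiffOn_density_jetMap L T hT).sub (contDiffOn_density_jetMap L T' hT')

theorem Lagrangian.eval_comap (L : Lagrangian W' D') (T : W →L[ℝ] W') (hT : Set.MapsTo T D D')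
    {u : Spacetime → W} (hu : ContDiff ℝ ∞ u) (x : Spacetime) :
    (L.comap T hT).eval u x = L.eval (T ∘ u) x :=
  congrArg L.density (jetMap_jet L.order T hu x)

theorem Lagrangian.eval_comapSub (L : Lagrangian W' D') (T T' : W →L[ℝ] W')
    (hT : Set.MapsTo T D D') (hT' : Set.MapsTo T' D D')
    {u : Spacetime → W} (hu : ContDiff ℝ ∞ u) (x : Spacetime) :
    (L.comapSub T T' hT hT').eval u x = L.eval (T ∘ u) x - L.eval (T' ∘ u) x :=
  congrArg₂ (fun a b => L.density a - L.density b) (jetMap_jet L.order T hu x)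
    (jetMap_jet L.order T' hu x)

end Substitution

/-! ### Smoothness of the ether Lagrangian -/

theorem IsLorentz.det_neg {A : MetricVal} (hA : IsLorentz A) : (Matrix.of A).det < 0 := by
  obtain ⟨P, hP, h⟩ := hA
  have hP' : P.det ≠ 0 := hP.ne_zero
  rw [h, Matrix.det_mul, Matrix.det_mul, Matrix.det_transpose, Matrix.det_diagonal]
  have : 0 < P.det * P.det := mul_self_pos.2 hP'
  simp only [Fin.prod_univ_four, Matrix.cons_val]
  linarith

theorem IsLorentz.isSymm {A : MetricVal} (hA : IsLorentz A) : (Matrix.of A).IsSymm := by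
  obtain ⟨P, -, h⟩ := hA
  rw [Matrix.IsSymm, h]
  simp [Matrix.transpose_mul, Matrix.mul_assoc]

theorem densInv_symm {A : MetricVal} (hA : IsLorentz A) (α β : Fin 4) :
    densInv A α β = densInv A β α := by
  have h : (Matrix.of A)⁻¹.transpose = (Matrix.of A)⁻¹ := by
    rw [Matrix.transpose_nonsing_inv, hA.isSymm.eq]
  rw [densInv, densInv, ← h, Matrix.transpose_apply, h]

theorem contDiff_det {M : Spacetime → Matrix (Fin 4) (Fin 4) ℝ}
    (hM : ∀ i j, ContDiff ℝ ∞ fun x => M x i j) : ContDiff ℝ ∞ fun x => (M x).det := by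
  simp only [Matrix.det_apply]
  exact ContDiff.sum fun σ _ => (contDiff_prod fun i _ => hM _ _).const_smul _

theorem contDiff_inv_apply {M : Spacetime → Matrix (Fin 4) (Fin 4) ℝ}
    (hM : ∀ i j, ContDiff ℝ ∞ fun x => M x i j) (hne : ∀ x, (M x).det ≠ 0) (i j : Fin 4) :
    ContDiff ℝ ∞ fun x => (M x)⁻¹ i j := by
  have hadj : ContDiff ℝ ∞ fun x => (M x).adjugate i j := by
    simp only [Matrix.adjugate_apply]
    refine contDiff_det fun k l => ?_
    by_cases hk : k = j
    · simp only [hk, Matrix.updateRow_self]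
      exact contDiff_const
    · simp only [Matrix.updateRow_ne hk]
      exact hM k l
  simp only [Matrix.inv_def, Ring.inverse_eq_inv', Matrix.smul_apply, smul_eq_mul]
  exact ((contDiff_det hM).inv hne).mul hadj

theorem contDiff_densInv {g : Spacetime → MetricVal} (hg : Admissible lorentz g)
    (α β : Fin 4) : ContDiff ℝ ∞ fun x => densInv (g x) α β := by
  have hent : ∀ i j, ContDiff ℝ ∞ fun x => Matrix.of (g x) i j := fun i j =>
    contDiff_pi.1 (contDiff_pi.1 hg.1 i) j
  have hne : ∀ x, (Matrix.of (g x)).det < 0 := fun x => IsLorentz.det_neg (hg.2 x)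
  exact (contDiff_inv_apply hent (fun x => (hne x).ne) α β).mul
    ((contDiff_det hent).neg.sqrt fun x => (neg_pos.2 (hne x)).ne')

theorem contDiff_partialDeriv {f : Spacetime → ℝ} (hf : ContDiff ℝ ∞ f) (α : Fin 4) :
    ContDiff ℝ ∞ (partialDeriv α f) :=
  (hf.fderiv_right (m := ∞) (by simp)).clm_apply contDiff_const

theorem partialDeriv_congr {f h : Spacetime → ℝ} {x : Spacetime} (hfh : f =ᶠ[𝓝 x] h)
    (α : Fin 4) : partialDeriv α f x = partialDeriv α h x := by
  rw [partialDeriv, partialDeriv, hfh.fderiv_eq]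
/-- The bilinear form `γ_{μν} X^μ_{,α} Y^ν_{,β} g^{αβ} √(-g)` whose diagonal is, up to a factor,
the ether Lagrangian. -/
noncomputable def gradForm (Υ Ξ : ℝ) (g : Spacetime → MetricVal) (X Y : Spacetime → PrefVal)
    (x : Spacetime) : ℝ :=
  ∑ μ, ∑ ν, ∑ α, ∑ β,
    gammaMat Υ Ξ μ ν * partialDeriv α (fun y => X y μ) x * partialDeriv β (fun y => Y y ν) x
      * densInv (g x) α β

/-- The expression `(4πG)⁻¹ γ_{μν} □X^ν`. -/
noncomputable def etherSource (G Υ Ξ : ℝ) (g : Spacetime → MetricVal) (X : Spacetime → PrefVal)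
    (μ : Fin 4) (x : Spacetime) : ℝ :=
  (4 * Real.pi * G)⁻¹ * ∑ ν, gammaMat Υ Ξ μ ν * box g (fun y => X y ν) x

theorem contDiff_component {X : Spacetime → PrefVal} (hX : ContDiff ℝ ∞ X) (μ : Fin 4) :
    ContDiff ℝ ∞ fun y => X y μ :=
  contDiff_pi.1 hX μ

theorem contDiff_gradForm (Υ Ξ : ℝ) {g : Spacetime → MetricVal} {X Y : Spacetime → PrefVal}
    (hg : Admissible lorentz g) (hX : ContDiff ℝ ∞ X) (hY : ContDiff ℝ ∞ Y) :
    ContDiff ℝ ∞ (gradForm Υ Ξ g X Y) := by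
  refine ContDiff.sum fun μ _ => ContDiff.sum fun ν _ => ContDiff.sum fun α _ =>
    ContDiff.sum fun β _ => ?_
  exact ((contDiff_const.mul (contDiff_partialDeriv (contDiff_component hX μ) α)).mul
    (contDiff_partialDeriv (contDiff_component hY ν) β)).mul (contDiff_densInv hg α β)

/-- The flux `g^{αβ} √(-g) ∂_β f`, whose divergence is `□f`, is smooth. -/
theorem contDiff_flux {g : Spacetime → MetricVal} (hg : Admissible lorentz g)
    {f : Spacetime → ℝ} (hf : ContDiff ℝ ∞ f) (α : Fin 4) :
    ContDiff ℝ ∞ fun y => ∑ β, densInv (g y) α β * partialDeriv β f y :=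
  ContDiff.sum fun β _ => (contDiff_densInv hg α β).mul (contDiff_partialDeriv hf β)

theorem contDiff_box {g : Spacetime → MetricVal} (hg : Admissible lorentz g)
    {f : Spacetime → ℝ} (hf : ContDiff ℝ ∞ f) : ContDiff ℝ ∞ (box g f) :=
  ContDiff.sum fun α _ => contDiff_partialDeriv (contDiff_flux hg hf α) α

/-- The ether Lagrangian as a functional of all the fields. -/
noncomputable def etherFunctional {N : ℕ} (τ : Fin N → ℕ × ℕ) (G Υ Ξ : ℝ)
    (u : Spacetime → FullVal τ) (x : Spacetime) : ℝ :=
  etherCov G Υ Ξ (fun y => (u y).1) (fun y => (u y).2.1) x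

theorem isLocal_etherFunctional {N : ℕ} (τ : Fin N → ℕ × ℕ) (G Υ Ξ : ℝ) :
    IsLocal (fullDomain τ) (etherFunctional τ G Υ Ξ) where
  continuous u hu :=
    continuous_const.mul (contDiff_gradForm Υ Ξ (g := fun y => (u y).1)
      (X := fun y => (u y).2.1) (Y := fun y => (u y).2.1) ⟨hu.1.fst, hu.2⟩
      hu.1.snd.fst hu.1.snd.fst).continuous
  congr u v x h := by
    have hX : ∀ μ α, partialDeriv α (fun y => (u y).2.1 μ) x
        = partialDeriv α (fun y => (v y).2.1 μ) x := fun μ α =>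
      partialDeriv_congr (h.mono fun y hy => by simp only [hy]) α
    simp only [etherFunctional, etherCov, hX, h.eq_of_nhds]

/-! ### The variation of the ether action -/

theorem partialDeriv_add_smul {X ξ : Spacetime → PrefVal} (hX : ContDiff ℝ ∞ X)
    (hξ : ContDiff ℝ ∞ ξ) (s : ℝ) (μ α : Fin 4) (x : Spacetime) :
    partialDeriv α (fun y => (X + s • ξ) y μ) x
      = partialDeriv α (fun y => X y μ) x + s * partialDeriv α (fun y => ξ y μ) x := by
  have h1 := ((contDiff_component hX μ).differentiable (by simp) x).hasFDerivAt
  have h2 := ((contDiff_component hξ μ).differentiable (by simp) x).hasFDerivAt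
  have h := (h1.add (h2.const_smul s)).fderiv
  exact congrArg (fun T : Spacetime →L[ℝ] ℝ => T (Pi.single α 1)) h

theorem gradForm_symm (Υ Ξ : ℝ) {g : Spacetime → MetricVal} (hg : Admissible lorentz g)
    (X Y : Spacetime → PrefVal) (x : Spacetime) :
    gradForm Υ Ξ g X Y x = gradForm Υ Ξ g Y X x := by
  have hγ : ∀ μ ν, gammaMat Υ Ξ μ ν = gammaMat Υ Ξ ν μ := fun μ ν =>
    (Matrix.isSymm_diagonal ![Υ, -Ξ, -Ξ, -Ξ]).apply ν μ
  unfold gradForm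
  rw [Finset.sum_comm]
  refine Finset.sum_congr rfl fun ν _ => Finset.sum_congr rfl fun μ _ => ?_
  rw [Finset.sum_comm]
  refine Finset.sum_congr rfl fun β _ => Finset.sum_congr rfl fun α _ => ?_
  rw [hγ, densInv_symm (hg.2 x)]
  ring

theorem gradForm_add_smul (Υ Ξ : ℝ) {g : Spacetime → MetricVal} (hg : Admissible lorentz g)
    {X ξ : Spacetime → PrefVal} (hX : ContDiff ℝ ∞ X) (hξ : ContDiff ℝ ∞ ξ) (s : ℝ)
    (x : Spacetime) :
    gradForm Υ Ξ g (X + s • ξ) (X + s • ξ) x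
      = gradForm Υ Ξ g X X x + 2 * s * gradForm Υ Ξ g ξ X x + s ^ 2 * gradForm Υ Ξ g ξ ξ x := by
  have h : gradForm Υ Ξ g (X + s • ξ) (X + s • ξ) x = gradForm Υ Ξ g X X x
      + s * gradForm Υ Ξ g X ξ x + s * gradForm Υ Ξ g ξ X x + s ^ 2 * gradForm Υ Ξ g ξ ξ x := by
    simp only [gradForm, partialDeriv_add_smul hX hξ, Finset.mul_sum, ← Finset.sum_add_distrib]
    refine Finset.sum_congr rfl fun μ _ => Finset.sum_congr rfl fun ν _ =>
      Finset.sum_congr rfl fun α _ => Finset.sum_congr rfl fun β _ => ?_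
    ring
  rw [h, gradForm_symm Υ Ξ hg X ξ]
  ring

theorem hasCompactSupport_component {ξ : Spacetime → PrefVal} (hc : HasCompactSupport ξ)
    (μ : Fin 4) : HasCompactSupport fun y => ξ y μ :=
  hc.comp_left (g := fun v : PrefVal => v μ) rfl

theorem hasCompactSupport_partialDeriv {f : Spacetime → ℝ} (hc : HasCompactSupport f)
    (α : Fin 4) : HasCompactSupport (partialDeriv α f) :=
  hc.fderiv_apply ℝ _

theorem integral_partialDeriv_mul {f V : Spacetime → ℝ} (hf : ContDiff ℝ ∞ f)
    (hc : HasCompactSupport f) (hV : ContDiff ℝ ∞ V) (α : Fin 4) :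
    ∫ x, partialDeriv α f x * V x = -∫ x, f x * partialDeriv α V x := by
  have h := integral_mul_fderiv_eq_neg_fderiv_mul_of_integrable (μ := volume) (f := f) (g := V)
    (v := Pi.single α 1)
    (((contDiff_partialDeriv hf α).continuous.mul hV.continuous).integrable_of_hasCompactSupport
      (hasCompactSupport_partialDeriv hc α).mul_right)
    ((hf.continuous.mul (contDiff_partialDeriv hV α).continuous).integrable_of_hasCompactSupport
      hc.mul_right)
    ((hf.continuous.mul hV.continuous).integrable_of_hasCompactSupport hc.mul_right)
    (fun x _ => hf.differentiable (by simp) x) (fun x _ => hV.differentiable (by simp) x)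
  exact (neg_eq_iff_eq_neg.2 h).symm

theorem integral_flux_eq_neg_box {f h : Spacetime → ℝ} (hf : ContDiff ℝ ∞ f)
    (hc : HasCompactSupport f) {g : Spacetime → MetricVal} (hg : Admissible lorentz g)
    (hh : ContDiff ℝ ∞ h) :
    ∫ x, ∑ α, partialDeriv α f x * ∑ β, densInv (g x) α β * partialDeriv β h x
      = -∫ x, f x * box g h x := by
  have e : ∀ x, f x * box g h x = ∑ α, f x *
      partialDeriv α (fun y => ∑ β, densInv (g y) α β * partialDeriv β h y) x :=
    fun x => Finset.mul_sum ..
  simp only [e]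
  rw [integral_finsetSum, integral_finsetSum, ← Finset.sum_neg_distrib]
  · exact Finset.sum_congr rfl fun α _ =>
      integral_partialDeriv_mul hf hc (contDiff_flux hg hh α) α
  · exact fun α _ => (hf.continuous.mul (contDiff_partialDeriv
      (contDiff_flux hg hh α) α).continuous).integrable_of_hasCompactSupport hc.mul_right
  · exact fun α _ => ((contDiff_partialDeriv hf α).continuous.mul
      (contDiff_flux hg hh α).continuous).integrable_of_hasCompactSupport
      (hasCompactSupport_partialDeriv hc α).mul_right

/-- Integration by parts: the weak form of the operator `γ_{μν} □`. -/
theorem integral_gradForm (G Υ Ξ : ℝ) {g : Spacetime → MetricVal} (hg : Admissible lorentz g)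
    {X ξ : Spacetime → PrefVal} (hX : ContDiff ℝ ∞ X) (hξ : ContDiff ℝ ∞ ξ)
    (hc : HasCompactSupport ξ) :
    (4 * Real.pi * G)⁻¹ * ∫ x, gradForm Υ Ξ g ξ X x
      = -∫ x, ∑ μ, etherSource G Υ Ξ g X μ x * ξ x μ := by
  have e1 : ∀ x, gradForm Υ Ξ g ξ X x = ∑ μ, ∑ ν, gammaMat Υ Ξ μ ν *
      ∑ α, partialDeriv α (fun y => ξ y μ) x *
        ∑ β, densInv (g x) α β * partialDeriv β (fun y => X y ν) x := fun x => by
    simp only [gradForm, Finset.mul_sum]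
    refine Finset.sum_congr rfl fun μ _ => Finset.sum_congr rfl fun ν _ =>
      Finset.sum_congr rfl fun α _ => Finset.sum_congr rfl fun β _ => ?_
    ring
  have e2 : ∀ x, ∑ μ, etherSource G Υ Ξ g X μ x * ξ x μ = (4 * Real.pi * G)⁻¹ *
      ∑ μ, ∑ ν, gammaMat Υ Ξ μ ν * (ξ x μ * box g (fun y => X y ν) x) := fun x => by
    simp only [etherSource, Finset.mul_sum, Finset.sum_mul]
    refine Finset.sum_congr rfl fun μ _ => Finset.sum_congr rfl fun ν _ => ?_
    ring
  have i1 : ∀ μ ν, Integrable fun x => gammaMat Υ Ξ μ ν *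
      ∑ α, partialDeriv α (fun y => ξ y μ) x *
        ∑ β, densInv (g x) α β * partialDeriv β (fun y => X y ν) x := fun μ ν =>
    (integrable_finsetSum _ fun α _ =>
      ((contDiff_partialDeriv (contDiff_component hξ μ) α).continuous.mul
        (contDiff_flux hg (contDiff_component hX ν) α).continuous).integrable_of_hasCompactSupport
        (hasCompactSupport_partialDeriv (hasCompactSupport_component hc μ) α).mul_right).const_mul _
  have i2 : ∀ μ ν, Integrable fun x =>
      gammaMat Υ Ξ μ ν * (ξ x μ * box g (fun y => X y ν) x) := fun μ ν =>
    (((contDiff_component hξ μ).continuous.mul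
      (contDiff_box hg (contDiff_component hX ν)).continuous).integrable_of_hasCompactSupport
      (hasCompactSupport_component hc μ).mul_right).const_mul _
  simp only [e1, e2, integral_const_mul]
  rw [← mul_neg, integral_finsetSum _ fun μ _ => integrable_finsetSum _ fun ν _ => i1 μ ν,
    integral_finsetSum _ fun μ _ => integrable_finsetSum _ fun ν _ => i2 μ ν,
    ← Finset.sum_neg_distrib]
  congr 1
  refine Finset.sum_congr rfl fun μ _ => ?_
  rw [integral_finsetSum _ fun ν _ => i1 μ ν, integral_finsetSum _ fun ν _ => i2 μ ν,
    ← Finset.sum_neg_distrib]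
  refine Finset.sum_congr rfl fun ν _ => ?_
  rw [integral_const_mul, integral_const_mul, integral_flux_eq_neg_box (contDiff_component hξ μ)
    (hasCompactSupport_component hc μ) hg (contDiff_component hX ν), mul_neg]

section Fields

variable {N : ℕ} {τ : Fin N → ℕ × ℕ} {g : Spacetime → MetricVal} {X ξ : Spacetime → PrefVal}
  {φ : Spacetime → MatterVal τ}

theorem admissible_fullFields (hg : Admissible lorentz g) (hX : ContDiff ℝ ∞ X)
    (hφ : ContDiff ℝ ∞ φ) : Admissible (fullDomain τ) (fullFields g X φ) :=
  ⟨hg.1.prodMk (hX.prodMk hφ), hg.2⟩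

theorem fullFields_add_smul_eq_of_notMem (s t : ℝ) {x : Spacetime} (hx : x ∉ tsupport ξ) :
    fullFields g (X + s • ξ) φ x = fullFields g (X + t • ξ) φ x := by
  simp [fullFields, image_eq_zero_of_notMem_tsupport hx]

/-- The ether action is quadratic in the preferred coordinates. -/
theorem actionChange_etherFunctional (G Υ Ξ : ℝ) (hg : Admissible lorentz g)
    (hX : ContDiff ℝ ∞ X) (hξ : ContDiff ℝ ∞ ξ) (hc : HasCompactSupport ξ) (s : ℝ) :
    actionChange (etherFunctional τ G Υ Ξ) (fullFields g X φ) (fullFields g (X + s • ξ) φ)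
      = s * (∫ x, ∑ μ, etherSource G Υ Ξ g X μ x * ξ x μ)
        + s ^ 2 / 2 * ∫ x, ∑ μ, etherSource G Υ Ξ g ξ μ x * ξ x μ := by
  have hint : ∀ {Y : Spacetime → PrefVal}, ContDiff ℝ ∞ Y →
      Integrable (gradForm Υ Ξ g ξ Y) := fun {Y} hY => by
    refine (contDiff_gradForm Υ Ξ hg hξ hY).continuous.integrable_of_hasCompactSupport
      (HasCompactSupport.intro hc fun x hx => ?_)
    have h0 : ∀ μ α, partialDeriv α (fun y => ξ y μ) x = 0 := fun μ α =>
      image_eq_zero_of_notMem_tsupport fun hx' => hx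
        ((tsupport_fderiv_apply_subset ℝ _).trans
          (tsupport_comp_subset (g := fun v : PrefVal => v μ) rfl ξ) hx')
    simp [gradForm, h0]
  have hpt : ∀ x, etherFunctional τ G Υ Ξ (fullFields g (X + s • ξ) φ) x
      - etherFunctional τ G Υ Ξ (fullFields g X φ) x
      = -(s * (4 * Real.pi * G)⁻¹) * gradForm Υ Ξ g ξ X x
        + -(s ^ 2 / 2 * (4 * Real.pi * G)⁻¹) * gradForm Υ Ξ g ξ ξ x := fun x => by
    change -(8 * Real.pi * G)⁻¹ * gradForm Υ Ξ g (X + s • ξ) (X + s • ξ) x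
      - -(8 * Real.pi * G)⁻¹ * gradForm Υ Ξ g X X x = _
    have h8 : (8 * Real.pi * G)⁻¹ = (4 * Real.pi * G)⁻¹ / 2 := by
      rw [div_eq_mul_inv, ← mul_inv]
      ring_nf
    rw [gradForm_add_smul Υ Ξ hg hX hξ, h8]
    ring
  simp only [actionChange, hpt]
  rw [integral_add ((hint hX).const_mul _) ((hint hξ).const_mul _), integral_const_mul,
    integral_const_mul]
  linear_combination (-s) * integral_gradForm G Υ Ξ hg hX hξ hc
    - s ^ 2 / 2 * integral_gradForm G Υ Ξ hg hξ hξ hc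
theorem hasDerivAt_actionChange_etherFunctional (G Υ Ξ : ℝ) (hg : Admissible lorentz g)
    (hX : ContDiff ℝ ∞ X) (hξ : ContDiff ℝ ∞ ξ) (hc : HasCompactSupport ξ) :
    HasDerivAt (fun s : ℝ => actionChange (etherFunctional τ G Υ Ξ) (fullFields g X φ)
      (fullFields g (X + s • ξ) φ)) (∫ x, ∑ μ, etherSource G Υ Ξ g X μ x * ξ x μ) 0 := by
  simp only [actionChange_etherFunctional G Υ Ξ hg hX hξ hc]
  have h := ((hasDerivAt_id (0 : ℝ)).mul_const
    (∫ x, ∑ μ, etherSource G Υ Ξ g X μ x * ξ x μ)).add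
    ((((hasDerivAt_id (0 : ℝ)).pow 2).div_const 2).mul_const
      (∫ x, ∑ μ, etherSource G Υ Ξ g ξ μ x * ξ x μ))
  refine h.congr_deriv ?_
  simp

/-! ### Removing the preferred coordinates -/

/-- If the first variation of a local action in the preferred coordinates vanishes at all field
configurations, then finite changes of the preferred coordinates leave the action unchanged. -/
theorem IsLocal.actionChange_eq_zero {A : (Spacetime → FullVal τ) → Spacetime → ℝ}
    (hA : IsLocal (fullDomain τ) A) (hg : Admissible lorentz g) (hφ : ContDiff ℝ ∞ φ)
    (hξ : ContDiff ℝ ∞ ξ) (hc : HasCompactSupport ξ)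
    (hder : ∀ Y : Spacetime → PrefVal, ContDiff ℝ ∞ Y → HasDerivAt (fun s : ℝ =>
      actionChange A (fullFields g Y φ) (fullFields g (Y + s • ξ) φ)) 0 0)
    (hX : ContDiff ℝ ∞ X) :
    actionChange A (fullFields g X φ) (fullFields g (X + ξ) φ) = 0 := by
  set F : ℝ → ℝ := fun s => actionChange A (fullFields g X φ) (fullFields g (X + s • ξ) φ)
  have hsm : ∀ s : ℝ, ContDiff ℝ ∞ (X + s • ξ) := fun s => hX.add (hξ.const_smul s)
  have hadm : ∀ s : ℝ, Admissible (fullDomain τ) (fullFields g (X + s • ξ) φ) := fun s =>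
    admissible_fullFields hg (hsm s) hφ
  have h0 : X + (0 : ℝ) • ξ = X := by rw [zero_smul, add_zero]
  have hF : ∀ s, HasDerivAt F 0 s := fun s => by
    have hd := HasDerivAt.comp_sub_const (x := s) (a := s)
      (f := fun t : ℝ => actionChange A (fullFields g (X + s • ξ) φ)
        (fullFields g (X + s • ξ + t • ξ) φ)) (f' := 0) (by
          rw [sub_self]
          exact hder _ (hsm s))
    refine (hd.const_add (F s)).congr_of_eventuallyEq (Eventually.of_forall fun t => ?_)
    have ht : X + s • ξ + (t - s) • ξ = X + t • ξ := by
      rw [add_assoc, ← add_smul, add_sub_cancel]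
    change actionChange A (fullFields g X φ) (fullFields g (X + t • ξ) φ)
      = actionChange A (fullFields g X φ) (fullFields g (X + s • ξ) φ)
        + actionChange A (fullFields g (X + s • ξ) φ) (fullFields g (X + s • ξ + (t - s) • ξ) φ)
    rw [ht]
    refine hA.actionChange_trans (admissible_fullFields hg hX hφ) (hadm s) (hadm t) hc
      (fun x hx => ?_) fun x hx => fullFields_add_smul_eq_of_notMem t s hx
    have := fullFields_add_smul_eq_of_notMem (g := g) (X := X) (φ := φ) s 0 hx
    rwa [h0] at this
  have h10 : F 1 = F 0 :=
    is_const_of_deriv_eq_zero (fun s => (hF s).differentiableAt) (fun s => (hF s).deriv) 1 0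
  simpa [F, actionChange] using h10

/-- If the action of a local functional is unaffected by changes of `X` inside compact sets, then
`X` may be replaced by the constant `0`, although this is not a change inside a compact set:
it suffices to cut `X` off where the other fields vary. -/
theorem IsLocal.actionChange_eq_actionChange_zero
    {A : (Spacetime → FullVal τ) → Spacetime → ℝ} (hA : IsLocal (fullDomain τ) A)
    (hinv : ∀ (g : Spacetime → MetricVal) (X ξ : Spacetime → PrefVal)
      (φ : Spacetime → MatterVal τ), Admissible lorentz g → ContDiff ℝ ∞ X → ContDiff ℝ ∞ φ →
      ContDiff ℝ ∞ ξ → HasCompactSupport ξ →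
      actionChange A (fullFields g X φ) (fullFields g (X + ξ) φ) = 0)
    {g g' : Spacetime → MetricVal} {X X' : Spacetime → PrefVal} {φ φ' : Spacetime → MatterVal τ}
    (hg : Admissible lorentz g) (hg' : Admissible lorentz g') (hX : ContDiff ℝ ∞ X)
    (hX' : ContDiff ℝ ∞ X') (hφ : ContDiff ℝ ∞ φ) (hφ' : ContDiff ℝ ∞ φ')
    {K : Set Spacetime} (hK : IsCompact K)
    (h : ∀ x, x ∉ K → fullFields g' X' φ' x = fullFields g X φ x) :
    actionChange A (fullFields g X φ) (fullFields g' X' φ')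
      = actionChange A (fullFields g 0 φ) (fullFields g' 0 φ') := by
  obtain ⟨R, hRpos, hR⟩ := hK.isBounded.subset_ball_lt 0 0
  let χ : ContDiffBump (0 : Spacetime) := ⟨R, R + 1, hRpos, by linarith⟩
  have hχs : ContDiff ℝ ∞ (fun x => χ x) := χ.contDiff
  set C : Set Spacetime := K ∪ tsupport χ
  have hC : IsCompact C := hK.union χ.hasCompactSupport
  -- the correction `-χ Y` makes `Y` vanish near `K`
  let cut : (Spacetime → PrefVal) → Spacetime → PrefVal := fun Y x => -(χ x • Y x)
  have hcut : ∀ {Y : Spacetime → PrefVal}, ContDiff ℝ ∞ Y → ContDiff ℝ ∞ (cut Y) :=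
    fun hY => (hχs.smul hY).neg
  have hcutc : ∀ Y : Spacetime → PrefVal, HasCompactSupport (cut Y) := fun Y =>
    HasCompactSupport.intro χ.hasCompactSupport fun x hx => by
      simp [cut, image_eq_zero_of_notMem_tsupport hx]
  have hcut0 : ∀ (Y : Spacetime → PrefVal) (x : Spacetime), x ∉ C → (Y + cut Y) x = Y x :=
    fun Y x hx => by
      simp [cut, image_eq_zero_of_notMem_tsupport fun hx' => hx (Or.inr hx')]
  have hnear : ∀ (g : Spacetime → MetricVal) (Y : Spacetime → PrefVal)
      (φ : Spacetime → MatterVal τ) (x : Spacetime), x ∈ K →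
      A (fullFields g (Y + cut Y) φ) x = A (fullFields g 0 φ) x := fun g Y φ x hx => by
    refine hA.congr _ _ _ (mem_of_superset (Metric.isOpen_ball.mem_nhds (hR hx)) fun y hy => ?_)
    have h1 : χ y = 1 := χ.one_of_mem_closedBall (Metric.ball_subset_closedBall hy)
    simp [fullFields, cut, h1]
  have ha := admissible_fullFields hg hX hφ
  have ha' := admissible_fullFields hg' hX' hφ'
  have hb : Admissible (fullDomain τ) (fullFields g (X + cut X) φ) :=
    admissible_fullFields hg (hX.add (hcut hX)) hφ
  have hb' : Admissible (fullDomain τ) (fullFields g' (X' + cut X') φ') :=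
    admissible_fullFields hg' (hX'.add (hcut hX')) hφ'
  have hout : ∀ x, x ∉ K → g' x = g x ∧ X' x = X x ∧ φ' x = φ x := fun x hx => by
    simpa [fullFields] using h x hx
  have e1 : actionChange A (fullFields g X φ) (fullFields g' X' φ')
      = actionChange A (fullFields g (X + cut X) φ) (fullFields g' (X' + cut X') φ') := by
    have hK' : ∀ x, x ∉ C → x ∉ K := fun x hx hx' => hx (Or.inl hx')
    have t1 := hA.actionChange_trans ha ha' hb' hC (fun x hx => h x (hK' x hx))
      (fun x hx => by simp only [fullFields, hcut0 X' x hx])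
    have t2 := hA.actionChange_trans ha hb hb' hC
      (fun x hx => by simp only [fullFields, hcut0 X x hx])
      (fun x hx => by
        obtain ⟨h1, h2, h3⟩ := hout x (hK' x hx)
        simp only [fullFields, hcut0 X x hx, hcut0 X' x hx, h1, h2, h3])
    have z1 := hinv g X (cut X) φ hg hX hφ (hcut hX) (hcutc X)
    have z2 := hinv g' X' (cut X') φ' hg' hX' hφ' (hcut hX') (hcutc X')
    linarith
  rw [e1]
  refine integral_congr_ae (ae_of_all _ fun x => ?_)
  change _ - _ = _ - _
  by_cases hx : x ∈ K
  · rw [hnear g X φ x hx, hnear g' X' φ' x hx]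
  · have hl : A (fullFields g' (X' + cut X') φ') x = A (fullFields g (X + cut X) φ) x :=
      hA.eq_of_notMem hK (fun y hy => by
        obtain ⟨h1, h2, h3⟩ := hout y hy
        simp only [fullFields, cut, Pi.add_apply, h1, h2, h3]) hx
    have hr : A (fullFields g' 0 φ') x = A (fullFields g 0 φ) x :=
      hA.eq_of_notMem hK (fun y hy => by
        obtain ⟨h1, -, h3⟩ := hout y hy
        simp only [fullFields, h1, h3, Pi.zero_apply]) hx
    rw [hl, hr, sub_self, sub_self]

end Fields

/-! ### The Lagrangians of the metric and of the matter fields -/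

section Extraction

variable {N : ℕ} {τ : Fin N → ℕ × ℕ}

theorem pullMatter_zero (ψ : Spacetime → Spacetime) :
    pullMatter ψ (0 : Spacetime → MatterVal τ) = 0 := by
  funext x m a b
  simp [pullMatter]

/-- The substitution `g ↦ (g, 0, 0)`. -/
noncomputable def metricInclusion (τ : Fin N → ℕ × ℕ) : MetricVal →L[ℝ] FullVal τ :=
  (ContinuousLinearMap.id ℝ MetricVal).prod 0

/-- The substitution `(g, φ) ↦ (g, 0, φ)`. -/
noncomputable def grInclusion (τ : Fin N → ℕ × ℕ) : GRVal τ →L[ℝ] FullVal τ :=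
  (ContinuousLinearMap.fst ℝ _ _).prod
    ((0 : GRVal τ →L[ℝ] PrefVal).prod (ContinuousLinearMap.snd ℝ _ _))

/-- The Lagrangian `L(g, 0, 0)`: the preferred coordinates and the matter fields are replaced
by `0`. -/
noncomputable def Lagrangian.metricPart (L : Lagrangian (FullVal τ) (fullDomain τ)) :
    Lagrangian MetricVal lorentz :=
  L.comap (metricInclusion τ) fun _ h => h

/-- The Lagrangian `L(g, 0, φ) - L(g, 0, 0)`. -/
noncomputable def Lagrangian.matterPart (L : Lagrangian (FullVal τ) (fullDomain τ)) :
    Lagrangian (GRVal τ) (grDomain τ) :=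
  L.comapSub (grInclusion τ) ((metricInclusion τ).comp (ContinuousLinearMap.fst ℝ _ _))
    (fun _ h => h) fun _ h => h

variable (L : Lagrangian (FullVal τ) (fullDomain τ))

theorem Lagrangian.eval_metricPart {g : Spacetime → MetricVal} (hg : ContDiff ℝ ∞ g)
    (x : Spacetime) : L.metricPart.eval g x = L.eval (fullFields g 0 0) x :=
  L.eval_comap _ _ hg x

theorem Lagrangian.eval_matterPart {g : Spacetime → MetricVal} {φ : Spacetime → MatterVal τ}
    (hg : ContDiff ℝ ∞ g) (hφ : ContDiff ℝ ∞ φ) (x : Spacetime) :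
    L.matterPart.eval (grFields g φ) x
      = L.eval (fullFields g 0 φ) x - L.eval (fullFields g 0 0) x :=
  L.eval_comapSub _ _ _ _ (hg.prodMk hφ) x

theorem contDiff_jacobian {ψ : Spacetime → Spacetime} (hψ : ContDiff ℝ ∞ ψ) (a b : Fin 4) :
    ContDiff ℝ ∞ fun x => jacobian ψ x a b :=
  contDiff_partialDeriv (contDiff_pi.1 hψ a) b

theorem contDiff_pullMetric {ψ : Spacetime → Spacetime} (hψ : ContDiff ℝ ∞ ψ)
    {g : Spacetime → MetricVal} (hg : ContDiff ℝ ∞ g) : ContDiff ℝ ∞ (pullMetric ψ g) :=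
  contDiff_pi.2 fun a => contDiff_pi.2 fun b => ContDiff.sum fun c _ => ContDiff.sum fun d _ =>
    ((contDiff_jacobian hψ c a).mul (contDiff_jacobian hψ d b)).mul
      (contDiff_pi.1 (contDiff_pi.1 (hg.comp hψ) c) d)

theorem IsCoordChange.det_jacobian_ne_zero {ψ : Spacetime ≃ Spacetime} (hψ : IsCoordChange ψ)
    (x : Spacetime) : (jacobian ψ x).det ≠ 0 := by
  have hd : DifferentiableAt ℝ ψ x := hψ.1.differentiable (by simp) x
  have hd' : DifferentiableAt ℝ ψ.symm (ψ x) := hψ.2.differentiable (by simp) (ψ x)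
  have hJ : jacobian ψ x = LinearMap.toMatrix' (fderiv ℝ ψ x : Spacetime →ₗ[ℝ] Spacetime) := by
    ext a b
    rw [LinearMap.toMatrix'_apply]
    change fderiv ℝ (fun y => ψ y a) x (Pi.single b 1) = fderiv ℝ ψ x _ a
    rw [fderiv_apply hd]
    simp
  have hcomp : (fderiv ℝ ψ.symm (ψ x)).comp (fderiv ℝ ψ x) = ContinuousLinearMap.id ℝ _ := by
    rw [← fderiv_comp x hd' hd, Equiv.symm_comp_self, fderiv_id]
  have hmul : LinearMap.toMatrix' (fderiv ℝ ψ.symm (ψ x) : Spacetime →ₗ[ℝ] Spacetime)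
      * jacobian ψ x = 1 := by
    rw [hJ, ← LinearMap.toMatrix'_comp, ← ContinuousLinearMap.toLinearMap_comp, hcomp]
    exact LinearMap.toMatrix'_id
  exact (Matrix.isUnit_det_of_left_inverse hmul).ne_zero

theorem contDiff_pullMatter {ψ : Spacetime ≃ Spacetime} (hψ : IsCoordChange ψ)
    {φ : Spacetime → MatterVal τ} (hφ : ContDiff ℝ ∞ φ) : ContDiff ℝ ∞ (pullMatter ψ φ) := by
  refine contDiff_pi.2 fun m => contDiff_pi.2 fun a => contDiff_pi.2 fun b =>
    ContDiff.sum fun c _ => ContDiff.sum fun d _ => ?_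
  refine ((contDiff_prod fun i _ => ?_).mul (contDiff_prod fun j _ => ?_)).mul ?_
  · exact contDiff_inv_apply (contDiff_jacobian hψ.1) hψ.det_jacobian_ne_zero _ _
  · exact contDiff_jacobian hψ.1 _ _
  · exact contDiff_pi.1 (contDiff_pi.1 (contDiff_pi.1 (hφ.comp hψ.1) m) c) d

/-- Constant scalar fields keep their values under coordinate changes, so that a weakly covariant
Lagrangian becomes covariant in the remaining fields when `X` is replaced by `0`. -/
theorem WeakCovariant.eval_zero {L : Lagrangian (FullVal τ) (fullDomain τ)}
    (hL : WeakCovariant L) {ψ : Spacetime ≃ Spacetime} (hψ : IsCoordChange ψ)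
    {g : Spacetime → MetricVal} {φ : Spacetime → MatterVal τ} (hg : Admissible lorentz g)
    (hφ : ContDiff ℝ ∞ φ) (x : Spacetime) :
    L.eval (fullFields (pullMetric ψ g) 0 (pullMatter ψ φ)) x
      = |(jacobian ψ x).det| * L.eval (fullFields g 0 φ) (ψ x) :=
  hL ψ hψ g 0 φ hg contDiff_const hφ x

theorem WeakCovariant.strongCovariantMetric_metricPart
    {L : Lagrangian (FullVal τ) (fullDomain τ)} (hL : WeakCovariant L) :
    StrongCovariantMetric L.metricPart := by
  intro ψ hψ g hg x
  have h := hL.eval_zero hψ hg (φ := 0) contDiff_const x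
  rwa [pullMatter_zero, ← L.eval_metricPart (contDiff_pullMetric hψ.1 hg.1),
    ← L.eval_metricPart hg.1] at h

theorem WeakCovariant.strongCovariantMatter_matterPart
    {L : Lagrangian (FullVal τ) (fullDomain τ)} (hL : WeakCovariant L) :
    StrongCovariantMatter L.matterPart := by
  intro ψ hψ g φ hg hφ x
  have h := hL.eval_zero hψ hg (φ := 0) contDiff_const x
  rw [pullMatter_zero] at h
  rw [L.eval_matterPart (contDiff_pullMetric hψ.1 hg.1) (contDiff_pullMatter hψ hφ),
    L.eval_matterPart hg.1 hφ, hL.eval_zero hψ hg hφ, h, mul_sub]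

/-- The two parts together are `L(g, 0, φ)`. -/
theorem Lagrangian.eval_metricPart_add_eval_matterPart {g : Spacetime → MetricVal}
    {φ : Spacetime → MatterVal τ} (hg : ContDiff ℝ ∞ g) (hφ : ContDiff ℝ ∞ φ) (x : Spacetime) :
    L.metricPart.eval g x + L.matterPart.eval (grFields g φ) x
      = L.eval (fullFields g 0 φ) x := by
  rw [L.eval_metricPart hg, L.eval_matterPart hg hφ, add_sub_cancel]

end Extraction

/-! ### The two directions -/

section Equivalence

variable {N : ℕ} {τ : Fin N → ℕ × ℕ} {G Υ Ξ : ℝ} {L : Lagrangian (FullVal τ) (fullDomain τ)}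

theorem etherFunctional_zero (g : Spacetime → MetricVal) (φ : Spacetime → MatterVal τ)
    (x : Spacetime) : etherFunctional τ G Υ Ξ (fullFields g 0 φ) x = 0 := by
  have h0 : ∀ α, partialDeriv α (fun _ => (0 : ℝ)) x = 0 := fun α => by simp [partialDeriv]
  simp [etherFunctional, etherCov, fullFields, h0]

theorem etherCov_id (g : Spacetime → MetricVal) (x : Spacetime) :
    etherCov G Υ Ξ g id x = etherPref G Υ Ξ g x := by
  have h : ∀ μ α, partialDeriv α (fun y : Spacetime => y μ) x = if μ = α then 1 else 0 :=
    fun μ α => by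
      rw [partialDeriv, fderiv_apply differentiableAt_fun_id, fderiv_fun_id]
      simp [Pi.single_apply]
  simp [etherCov, etherPref, h]

/-- The two extracted Lagrangians add up to `L(g, 0, φ)`, so this says that the difference of `L`
and the ether Lagrangian has the action of that `X`-independent Lagrangian. -/
theorem LagrangeAxiom.sameAction (hLA : LagrangeAxiom G Υ Ξ L) :
    SameAction (fullDomain τ) L.eval (fun u x =>
      etherCov G Υ Ξ (fun y => (u y).1) (fun y => (u y).2.1) x
        + L.metricPart.eval (fun y => (u y).1) x
        + L.matterPart.eval (grFields (fun y => (u y).1) (fun y => (u y).2.2)) x) := by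
  rintro u u' hu hu' ⟨K, hK, hKu⟩
  have hE := isLocal_etherFunctional τ G Υ Ξ
  have hA := L.isLocal.sub hE
  have hinv : ∀ (g : Spacetime → MetricVal) (X ξ : Spacetime → PrefVal)
      (φ : Spacetime → MatterVal τ), Admissible lorentz g → ContDiff ℝ ∞ X → ContDiff ℝ ∞ φ →
      ContDiff ℝ ∞ ξ → HasCompactSupport ξ →
      actionChange (fun u x => L.eval u x - etherFunctional τ G Υ Ξ u x) (fullFields g X φ)
        (fullFields g (X + ξ) φ) = 0 := by
    intro g X ξ φ hg hX hφ hξ hc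
    refine hA.actionChange_eq_zero hg hφ hξ hc (fun Y hY => ?_) hX
    have hd := (hLA g Y φ hg hY hφ ξ hξ hc).sub
      (hasDerivAt_actionChange_etherFunctional (φ := φ) G Υ Ξ hg hY hξ hc)
    refine (hd.congr_deriv (sub_self _)).congr_of_eventuallyEq
      (Eventually.of_forall fun s => ?_)
    refine L.isLocal.actionChange_sub hE (admissible_fullFields hg hY hφ)
      (admissible_fullFields hg (hY.add (hξ.const_smul s)) hφ) hc fun x hx => ?_
    simpa using fullFields_add_smul_eq_of_notMem (g := g) (X := Y) (φ := φ) s 0 hx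
  have hzero := hA.actionChange_eq_actionChange_zero hinv (g := fun y => (u y).1)
    (g' := fun y => (u' y).1) (X := fun y => (u y).2.1) (X' := fun y => (u' y).2.1)
    (φ := fun y => (u y).2.2) (φ' := fun y => (u' y).2.2) ⟨hu.1.fst, hu.2⟩ ⟨hu'.1.fst, hu'.2⟩
    hu.1.snd.fst hu'.1.snd.fst hu.1.snd.snd hu'.1.snd.snd hK hKu
  have hsplit := L.isLocal.actionChange_sub hE hu hu' hK hKu
  have hK0 : ∀ x, x ∉ K → fullFields (fun y => (u' y).1) 0 (fun y => (u' y).2.2) x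
      = fullFields (fun y => (u y).1) 0 (fun y => (u y).2.2) x := fun x hx => by
    simp only [fullFields, hKu x hx, Pi.zero_apply]
  have hadm : ∀ {v : Spacetime → FullVal τ}, Admissible (fullDomain τ) v →
      Admissible (fullDomain τ) (fullFields (fun y => (v y).1) 0 fun y => (v y).2.2) :=
    fun hv => admissible_fullFields ⟨hv.1.fst, hv.2⟩ contDiff_const hv.1.snd.snd
  rw [sub_eq_iff_eq_add.1 (hsplit.symm.trans hzero), add_comm]
  refine (integral_add (hE.integrable_sub hu hu' hK hKu)
    (hA.integrable_sub (hadm hu) (hadm hu') hK hK0)).symm.trans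
    (integral_congr_ae (ae_of_all _ fun x => ?_))
  have e := L.eval_metricPart_add_eval_matterPart hu.1.fst hu.1.snd.snd x
  have e' := L.eval_metricPart_add_eval_matterPart hu'.1.fst hu'.1.snd.snd x
  simp only [etherFunctional_zero, ← e, ← e']
  simp only [etherFunctional]
  ring

/-- If `L` has the action of the ether Lagrangian up to terms without `X`, then the preferred
coordinates enter the action through the ether Lagrangian only. -/
theorem lagrangeAxiom_of_sameAction {P : (Spacetime → MetricVal) → Spacetime → ℝ}
    {Q : (Spacetime → GRVal τ) → Spacetime → ℝ}
    (h : SameAction (fullDomain τ) L.eval (fun u x =>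
      etherCov G Υ Ξ (fun y => (u y).1) (fun y => (u y).2.1) x + P (fun y => (u y).1) x
        + Q (grFields (fun y => (u y).1) (fun y => (u y).2.2)) x)) :
    LagrangeAxiom G Υ Ξ L := by
  intro g X φ hg hX hφ ξ hξ hc
  refine (hasDerivAt_actionChange_etherFunctional (φ := φ) G Υ Ξ hg hX hξ
    hc).congr_of_eventuallyEq (Eventually.of_forall fun s => ?_)
  refine (h _ _ (admissible_fullFields hg hX hφ)
    (admissible_fullFields hg (hX.add (hξ.const_smul s)) hφ) ⟨_, hc, fun x hx => ?_⟩).trans ?_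
  · have h0 := fullFields_add_smul_eq_of_notMem (g := g) (X := X) (φ := φ) s 0 hx
    rwa [zero_smul, add_zero] at h0
  · refine integral_congr_ae (ae_of_all _ fun x => ?_)
    exact add_sub_add_right_eq_sub _ _ _ |>.trans (add_sub_add_right_eq_sub _ _ _)

end Equivalence

end GET

theorem theorem1 {N : ℕ} (τ : Fin N → ℕ × ℕ) (G Υ Ξ : ℝ) (hG : 0 < G)
    (L : GET.Lagrangian (GET.FullVal τ) (GET.fullDomain τ)) (hL : GET.WeakCovariant L) :
    GET.LagrangeAxiom G Υ Ξ L ↔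
      ∃ (LGR : GET.Lagrangian GET.MetricVal GET.lorentz)
        (LM : GET.Lagrangian (GET.GRVal τ) (GET.grDomain τ)),
        GET.StrongCovariantMetric LGR ∧
        GET.StrongCovariantMatter LM ∧
        (∀ g : GET.Spacetime → GET.MetricVal, GET.Admissible GET.lorentz g →
          ∀ x, LM.eval (GET.grFields g 0) x = 0) ∧
        -- in arbitrary coordinates
        GET.SameAction (GET.fullDomain τ) L.eval
          (fun u x =>
            GET.etherCov G Υ Ξ (fun y => (u y).1) (fun y => (u y).2.1) x
              + LGR.eval (fun y => (u y).1) x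
              + LM.eval (GET.grFields (fun y => (u y).1) (fun y => (u y).2.2)) x) ∧
        -- in the preferred coordinates `X^μ(x) = x^μ`
        GET.SameAction (GET.grDomain τ)
          (fun w => L.eval (GET.fullFields (fun y => (w y).1) id (fun y => (w y).2)))
          (fun w x =>
            GET.etherPref G Υ Ξ (fun y => (w y).1) x
              + LGR.eval (fun y => (w y).1) x
              + LM.eval w x) := by
  constructor
  · intro hLA
    have hS := hLA.sameAction
    refine ⟨L.metricPart, L.matterPart, hL.strongCovariantMetric_metricPart,
      hL.strongCovariantMatter_matterPart, fun g hg x => ?_, hS, ?_⟩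
    · rw [L.eval_matterPart (φ := 0) hg.1 contDiff_const, sub_self]
    · rintro w w' hw hw' ⟨K, hK, hKw⟩
      have h := hS (GET.fullFields (fun y => (w y).1) id fun y => (w y).2)
        (GET.fullFields (fun y => (w' y).1) id fun y => (w' y).2)
        (GET.admissible_fullFields ⟨hw.1.fst, hw.2⟩ contDiff_id hw.1.snd)
        (GET.admissible_fullFields ⟨hw'.1.fst, hw'.2⟩ contDiff_id hw'.1.snd)
        ⟨K, hK, fun x hx => by simp only [GET.fullFields, hKw x hx]⟩
      simp only [← GET.etherCov_id]
      exact h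
  · rintro ⟨LGR, LM, -, -, -, hS, -⟩
    exact GET.lagrangeAxiom_of_sameAction (P := LGR.eval) (Q := LM.eval) hS
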